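/- Let $K$ be a field, let $S=K[x_1,\dots,x_n]$ and let $\mathfrak m=(x_1,\dots,x_n)$. For a monomial ideal $I\subset S$ let $G(I)$ denote its unique minimal set of monomial generators. A monomial ideal $I$ is called polymatroidal if all elements of $G(I)$ have the same degree and, for all $u,v\in G(I)$ and all $i$ with $\deg_{x_i}(u)>\deg_{x_i}(v)$, there exists $j$ with $\deg_{x_j}(u)<\deg_{x_j}(v)$ and $x_j(u/x_i)\in G(I)$; here $\deg_{x_i}(u)$ is the largest $k$ such that $x_i^k$ divides $u$, and the zero ideal counts as polymatroidal. For a polymatroidal ideal $I$ generated in degree $d$, the socle ideal $\operatorname{soc}(I)$ is the monomial ideal generated by the elements of degree $d-1$ of $G(I:\mathfrak m)$ (with $\operatorname{soc}(0)=0$). Let $I\subset S$ be a polymatroidal ideal. If $I$ is generated in degree two, or if $n\le 3$, then $\operatorname{soc}(I)$ is a polymatroidal ideal. -/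

import Mathlib

/-- An ideal of `K[x_1, …, x_n]` is monomial if it is generated by a set of monomials `x^a`. -/
def IsMonomialIdeal {K : Type*} [Field K] {n : ℕ} (I : Ideal (MvPolynomial (Fin n) K)) : Prop :=
  ∃ A : Set (Fin n →₀ ℕ), I = Ideal.span ((fun a => MvPolynomial.monomial a (1 : K)) '' A)

/-- The exponent vectors of the elements of `G(I)`, the unique minimal set of monomial generators
of a monomial ideal `I`: the monomials of `I` that are minimal with respect to divisibility.
A monomial `x^a` is identified with its multidegree `a`, so divisibility is `≤`. -/
def minGens {K : Type*} [Field K] {n : ℕ} (I : Ideal (MvPolynomial (Fin n) K)) :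
    Set (Fin n →₀ ℕ) :=
  {a | Minimal (fun b : Fin n →₀ ℕ => MvPolynomial.monomial b (1 : K) ∈ I) a}

/-- All minimal monomial generators of `I` have degree `d`. -/
def IsGeneratedInDegree {K : Type*} [Field K] {n : ℕ} (I : Ideal (MvPolynomial (Fin n) K))
    (d : ℕ) : Prop :=
  ∀ u ∈ minGens I, u.degree = d

/-- A polymatroidal ideal: a monomial ideal, generated in a single degree, with the exchange
property: for all `u, v ∈ G(I)` and all `i` with `deg_{x_i}(u) > deg_{x_i}(v)` there is `j` with
`deg_{x_j}(u) < deg_{x_j}(v)` and `x_j (u / x_i) ∈ G(I)`. (The subtraction is exact, since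
`u i > v i ≥ 0`.) The zero ideal is polymatroidal. -/
structure IsPolymatroidal {K : Type*} [Field K] {n : ℕ}
    (I : Ideal (MvPolynomial (Fin n) K)) : Prop where
  isMonomialIdeal : IsMonomialIdeal I
  equigenerated : ∃ d : ℕ, IsGeneratedInDegree I d
  exchange : ∀ u ∈ minGens I, ∀ v ∈ minGens I, ∀ i : Fin n, v i < u i →
    ∃ j : Fin n, u j < v j ∧ u - Finsupp.single i 1 + Finsupp.single j 1 ∈ minGens I

/-- The graded maximal ideal `𝔪 = (x_1, …, x_n)`. -/
noncomputable def maxGradedIdeal (K : Type*) [Field K] (n : ℕ) : Ideal (MvPolynomial (Fin n) K) :=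
  Ideal.span (Set.range MvPolynomial.X)

/-- The socle ideal of an equigenerated monomial ideal `I`: if `I` is generated in degree `d`, it is
the monomial ideal generated by the minimal monomial generators of `I : 𝔪` of degree `d - 1`. -/
noncomputable def socleIdeal {K : Type*} [Field K] {n : ℕ} (I : Ideal (MvPolynomial (Fin n) K)) :
    Ideal (MvPolynomial (Fin n) K) :=
  Ideal.span ((fun a => MvPolynomial.monomial a (1 : K)) ''
    {w | w ∈ minGens (Submodule.colon I (maxGradedIdeal K n : Set (MvPolynomial (Fin n) K))) ∧
      ∃ u ∈ minGens I, w.degree + 1 = u.degree})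

/-! A socle generator of an ideal with generating exponents `B` is a `w` with all `w + e_k` in `B`.
If `B` has degree two, these are variables, and any set of variables has exchange
(`of_degree_eq_one`). In at most three variables, `B` is the full degree-`d` slice of a box
(`mem_of_forall_exists_le`). So for socle elements `u`, `v` with `u i > v i`, any `j` with `u j < v
j` works: the coordinates of `u - e_i + e_j + e_k` stay within bounds attained at translates of `u`
and `v` (`HasExchange.socle`). -/

open Finsupp in
/-- The exchange property of a set of exponent vectors, in subtraction-free form. -/
def HasExchange {σ : Type*} (B : Set (σ →₀ ℕ)) : Prop :=
  ∀ u ∈ B, ∀ v ∈ B, ∀ i, v i < u i →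
    ∃ j, u j < v j ∧ ∃ w ∈ B, w + single i 1 = u + single j 1

namespace Finsupp

variable {σ : Type*}

lemma exists_lt_of_degree_eq {u v : σ →₀ ℕ} (h : u.degree = v.degree) {i : σ}
    (hi : v i < u i) : ∃ j, u j < v j := by
  by_contra! hle
  have hvu : v ≤ u := fun j => hle j
  have hadd : (u - v) + v = u := tsub_add_cancel_of_le hvu
  have hd : (u - v).degree = 0 := by
    have := congrArg degree hadd
    rw [map_add] at this
    omega
  have h0 : u - v = 0 := (degree_eq_zero_iff _).1 hd
  have := DFunLike.congr_fun h0 i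
  simp only [tsub_apply, zero_apply] at this
  omega

lemma eq_of_le_of_degree_eq {u v : σ →₀ ℕ} (hle : u ≤ v) (h : u.degree = v.degree) : u = v := by
  by_contra hne
  obtain ⟨i, hi⟩ : ∃ i, u i ≠ v i := by
    by_contra! hall
    exact hne (Finsupp.ext hall)
  obtain ⟨j, hj⟩ := exists_lt_of_degree_eq h.symm (lt_of_le_of_ne (hle i) hi)
  exact absurd (hle j) (by omega)

/-- The degree of the truncated `p - x` measures the distance from `p` to `x`; it is the induction
measure below. -/
lemma degree_tsub_lt_of_exchange [DecidableEq σ] {p q x : σ →₀ ℕ} {i k : σ}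
    (h : q + single i 1 = p + single k 1) (hi : x i < p i) (hk : p k < x k) :
    (q - x).degree < (p - x).degree := by
  have heq : (q - x) + single i 1 = p - x := by
    ext t
    have ht := DFunLike.congr_fun h t
    simp only [add_apply, tsub_apply, single_apply] at ht ⊢
    grind
  have := congrArg degree heq
  rw [map_add, degree_single] at this
  omega

end Finsupp

/-! ### Combinatorics of discrete polymatroids -/

namespace HasExchange

open Finsupp

variable {σ : Type*} {B : Set (σ →₀ ℕ)}

/-- Exchange prescribing the coordinate to raise: move `v` towards `u`, keeping `v k > u k`, until
`v ≤ u + e_k`; equality of degrees then forces `v = u + e_k - e_j`. -/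
lemma dual [DecidableEq σ] (hB : HasExchange B) {d : ℕ} (hd : ∀ u ∈ B, u.degree = d)
    {u v : σ →₀ ℕ} (hu : u ∈ B) (hv : v ∈ B) {k : σ} (hk : u k < v k) :
    ∃ j, j ≠ k ∧ ∃ w ∈ B, w + single j 1 = u + single k 1 := by
  induction hm : (v - u).degree using Nat.strong_induction_on generalizing v with
  | _ m ih =>
    subst hm
    by_cases h : ∃ i, u i + (if i = k then 1 else 0) < v i
    · obtain ⟨i, hi⟩ := h
      obtain ⟨j, hj, w, hw, hwe⟩ := hB v hv u hu i (by omega)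
      have hjk : j ≠ k := by rintro rfl; omega
      refine ih _ (degree_tsub_lt_of_exchange hwe (by omega) hj) hw ?_ rfl
      have ht := DFunLike.congr_fun hwe k
      simp only [Finsupp.add_apply, single_apply] at ht
      grind
    · push Not at h
      have hle : v ≤ u + single k 1 := by
        intro t
        have := h t
        simp only [Finsupp.add_apply, single_apply]
        grind
      obtain ⟨j, hj⟩ := exists_lt_of_degree_eq ((hd v hv).trans (hd u hu).symm) hk
      refine ⟨j, by rintro rfl; omega, v, hv, ?_⟩
      refine eq_of_le_of_degree_eq (fun t => ?_) (by
        rw [map_add, map_add, degree_single, degree_single, hd v hv, hd u hu])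
      have := hle t
      simp only [Finsupp.add_apply, single_apply] at this ⊢
      grind

/-- With at most three variables, the bases of a discrete polymatroid are cut out by bounds on the
single coordinates. -/
lemma mem_of_forall_exists_le [Fintype σ] [DecidableEq σ] (hσ : Fintype.card σ ≤ 3)
    (hB : HasExchange B) {d : ℕ} (hd : ∀ u ∈ B, u.degree = d) (hne : B.Nonempty)
    {x : σ →₀ ℕ} (hx : x.degree = d) (hl : ∀ t, ∃ q ∈ B, q t ≤ x t)
    (hr : ∀ t, ∃ r ∈ B, x t ≤ r t) : x ∈ B := by
  obtain ⟨p, hp⟩ := hne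
  induction hm : (p - x).degree using Nat.strong_induction_on generalizing p with
  | _ m ih =>
    subst hm
    by_cases hpx : p = x
    · exact hpx ▸ hp
    obtain ⟨i, hi⟩ : ∃ i, x i < p i := by
      by_contra! hle
      exact hpx (eq_of_le_of_degree_eq hle ((hd p hp).trans hx.symm))
    obtain ⟨k, hk⟩ := exists_lt_of_degree_eq ((hd p hp).trans hx.symm) hi
    have hik : i ≠ k := by rintro rfl; omega
    obtain ⟨q, hq, hqi⟩ := hl i
    obtain ⟨j, hj, a, ha, hae⟩ := hB p hp q hq i (by omega)
    by_cases hjx : p j < x j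
    · exact ih _ (degree_tsub_lt_of_exchange hae hi hjx) a ha rfl
    obtain ⟨r, hr, hrk⟩ := hr k
    obtain ⟨j', hj', b, hb, hbe⟩ := hB.dual hd hp hr (k := k) (by omega)
    by_cases hjx' : x j' < p j'
    · exact ih _ (degree_tsub_lt_of_exchange hbe hjx' hk) b hb rfl
    have hij : i ≠ j := by rintro rfl; omega
    have hkj : k ≠ j := by rintro rfl; omega
    have hij' : i ≠ j' := by rintro rfl; omega
    -- Both one-step moves failed to approach `x`, so `j` and `j'` avoid `i` and `k`; with three
    -- variables they coincide.
    have hjj : j = j' := by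
      by_contra hjj
      have hcard : ({i, k, j, j'} : Finset σ).card = 4 := by
        rw [Finset.card_insert_of_notMem, Finset.card_insert_of_notMem,
          Finset.card_insert_of_notMem, Finset.card_singleton] <;> grind
      have := Finset.card_le_univ ({i, k, j, j'} : Finset σ)
      omega
    subst hjj
    have hval : ∀ t, a t + (if i = t then 1 else 0) = p t + (if j = t then 1 else 0) ∧
        b t + (if j = t then 1 else 0) = p t + (if k = t then 1 else 0) := fun t => by
      have h1 := DFunLike.congr_fun hae t
      have h2 := DFunLike.congr_fun hbe t
      simp only [Finsupp.add_apply, single_apply] at h1 h2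
      exact ⟨h1, h2⟩
    -- Here `a = p - e_i + e_j` and `b = p + e_k - e_j`. Only at `j` is `b` below `a`, so exchange
    -- must give `c = p - e_i + e_k`, which is closer to `x`.
    obtain ⟨s, hs, c, hc, hce⟩ := hB b hb a ha i (by have := hval i; grind)
    have hsj : s = j := by have := hval s; grind
    subst hsj
    refine ih _ (degree_tsub_lt_of_exchange (p := p) (q := c) (i := i) (k := k) ?_ hi hk) c hc rfl
    rw [hce, hbe]

/-- The exchange property passes to the socle of a discrete polymatroid in at most three
variables. -/
lemma socle [Fintype σ] [DecidableEq σ] (hσ : Fintype.card σ ≤ 3)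
    (hB : HasExchange B) {d : ℕ} (hd : ∀ u ∈ B, u.degree = d) :
    HasExchange {w | ∀ k, w + single k 1 ∈ B} := by
  intro u hu v hv i hi
  have hdeg : ∀ w : σ →₀ ℕ, (∀ k, w + single k 1 ∈ B) → w.degree + 1 = d := fun w hw => by
    rw [← hd _ (hw i), map_add, degree_single]
  obtain ⟨j, hj⟩ := exists_lt_of_degree_eq (by have := hdeg u hu; have := hdeg v hv; omega) hi
  have hij : i ≠ j := by rintro rfl; omega
  have hw : u - single i 1 + single j 1 + single i 1 = u + single j 1 := by
    rw [add_right_comm, tsub_add_cancel_of_le]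
    rw [single_le_iff]; omega
  generalize u - single i 1 + single j 1 = w at hw
  refine ⟨j, hj, w, fun k => ?_, hw⟩
  have hval : ∀ t, w t + (if i = t then 1 else 0) = u t + (if j = t then 1 else 0) := fun t => by
    simpa only [Finsupp.add_apply, single_apply] using DFunLike.congr_fun hw t
  refine hB.mem_of_forall_exists_le hσ hd ⟨_, hu i⟩ ?_ (fun t => ?_) (fun t => ?_)
  · have := congrArg degree hw
    have := hdeg u hu
    simp only [map_add, degree_single] at *
    omega
  · have := hval t
    -- Only coordinate `i` was lowered, and there `v i < u i` supplies the bound; the upper bound at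
    -- `j` is symmetric.
    by_cases ht : t = i
    · refine ⟨_, hv j, ?_⟩
      simp only [Finsupp.add_apply, single_apply]
      grind
    · refine ⟨_, hu i, ?_⟩
      simp only [Finsupp.add_apply, single_apply]
      grind
  · have := hval t
    by_cases ht : t = j
    · refine ⟨_, hv j, ?_⟩
      simp only [Finsupp.add_apply, single_apply]
      grind
    · refine ⟨_, hu t, ?_⟩
      simp only [Finsupp.add_apply, single_apply]
      grind

/-- A set of exponent vectors of degree one has the exchange property. -/
lemma of_degree_eq_one (hd : ∀ u ∈ B, u.degree = 1) : HasExchange B := by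
  classical
  intro u hu v hv i hi
  obtain ⟨j, hj⟩ := exists_lt_of_degree_eq ((hd u hu).trans (hd v hv).symm) hi
  have hui : single i 1 = u := eq_of_le_of_degree_eq (single_le_iff.2 (by omega)) (by
    rw [degree_single, hd u hu])
  have hvj : single j 1 = v := eq_of_le_of_degree_eq (single_le_iff.2 (by omega)) (by
    rw [degree_single, hd v hv])
  exact ⟨j, hj, v, hv, by rw [hui, hvj, add_comm]⟩

end HasExchange

/-! ### Translation between monomial ideals and exponent sets -/

section MonomialIdeals

open Finsupp MvPolynomial

variable {K : Type*} [Field K] {n : ℕ} {I : Ideal (MvPolynomial (Fin n) K)}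

lemma exists_minGens_le {b : Fin n →₀ ℕ} (hb : monomial b (1 : K) ∈ I) :
    ∃ a ∈ minGens I, a ≤ b := by
  obtain ⟨a, hab, ha⟩ := exists_minimal_le_of_wellFoundedLT
    (fun b : Fin n →₀ ℕ => monomial b (1 : K) ∈ I) b hb
  exact ⟨a, ha, hab⟩

lemma IsGeneratedInDegree.mem_minGens_iff {d : ℕ} (hI : IsGeneratedInDegree I d)
    {b : Fin n →₀ ℕ} : b ∈ minGens I ↔ monomial b (1 : K) ∈ I ∧ b.degree = d := by
  refine ⟨fun hb => ⟨hb.1, hI b hb⟩, fun ⟨hb, hd⟩ => ?_⟩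
  obtain ⟨a, ha, hab⟩ := exists_minGens_le hb
  exact eq_of_le_of_degree_eq hab ((hI a ha).trans hd.symm) ▸ ha

lemma monomial_mem_span_monomial_iff {A : Set (Fin n →₀ ℕ)} {b : Fin n →₀ ℕ} :
    monomial b (1 : K) ∈ Ideal.span ((fun a => monomial a (1 : K)) '' A) ↔ ∃ a ∈ A, a ≤ b := by
  classical
  rw [mem_ideal_span_monomial_image]
  simp [support_monomial]

lemma minGens_span_monomial {A : Set (Fin n →₀ ℕ)} {d : ℕ} (hA : ∀ a ∈ A, a.degree = d) :
    minGens (Ideal.span ((fun a => monomial a (1 : K)) '' A)) = A := by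
  ext b
  constructor
  · intro hb
    obtain ⟨a, ha, hab⟩ := monomial_mem_span_monomial_iff.1 hb.1
    have hba : b ≤ a := hb.2 (monomial_mem_span_monomial_iff.2 ⟨a, ha, le_rfl⟩) hab
    exact le_antisymm hba hab ▸ ha
  · intro hb
    refine ⟨monomial_mem_span_monomial_iff.2 ⟨b, hb, le_rfl⟩, fun c hc hcb => ?_⟩
    obtain ⟨a, ha, hac⟩ := monomial_mem_span_monomial_iff.1 hc
    exact eq_of_le_of_degree_eq (hac.trans hcb) ((hA a ha).trans (hA b hb).symm) ▸ hac

lemma monomial_mem_colon_iff {w : Fin n →₀ ℕ} :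
    monomial w (1 : K) ∈
        Submodule.colon I (maxGradedIdeal K n : Set (MvPolynomial (Fin n) K)) ↔
      ∀ k, monomial (w + single k 1) (1 : K) ∈ I := by
  have hX : ∀ k, monomial w (1 : K) * X k = monomial (w + single k 1) (1 : K) := fun k => by
    rw [X, monomial_mul, one_mul]
  rw [Submodule.mem_colon]
  constructor
  · intro h k
    rw [← hX k]
    exact h (X k) (Ideal.subset_span ⟨k, rfl⟩)
  · intro h p hp
    refine Submodule.span_induction ?_ ?_ ?_ ?_ hp
    · rintro _ ⟨k, rfl⟩
      rw [smul_eq_mul, hX k]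
      exact h k
    · simp
    · intro x y _ _ hx hy
      rw [smul_add]
      exact I.add_mem hx hy
    · intro a x _ hx
      rw [smul_comm]
      exact I.smul_mem a hx

/-- The generators of the socle ideal, in terms of those of `I`. -/
lemma mem_minGens_colon_iff {d : ℕ} (hI : IsGeneratedInDegree I d) (hn : Nonempty (Fin n))
    {w : Fin n →₀ ℕ} :
    (w ∈ minGens (Submodule.colon I (maxGradedIdeal K n : Set (MvPolynomial (Fin n) K))) ∧
        ∃ u ∈ minGens I, w.degree + 1 = u.degree) ↔ ∀ k, w + single k 1 ∈ minGens I := by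
  constructor
  · rintro ⟨hw, u, hu, hwu⟩ k
    refine hI.mem_minGens_iff.2 ⟨monomial_mem_colon_iff.1 hw.1 k, ?_⟩
    rw [map_add, degree_single, hwu, hI u hu]
  · intro h
    obtain ⟨i⟩ := hn
    refine ⟨⟨monomial_mem_colon_iff.2 fun k => (h k).1, fun b hb hbw => ?_⟩, _, h i, by
      rw [map_add, degree_single]⟩
    -- Minimality of `w` follows from that of `w + e_i` in `I`, once some variable exists.
    exact le_of_add_le_add_right ((h i).2 (monomial_mem_colon_iff.1 hb i)
      (add_le_add_left hbw (single i 1)))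

lemma IsPolymatroidal.hasExchange (hI : IsPolymatroidal I) : HasExchange (minGens I) := by
  intro u hu v hv i hi
  obtain ⟨j, hj, hw⟩ := hI.exchange u hu v hv i hi
  refine ⟨j, hj, _, hw, ?_⟩
  rw [add_right_comm, tsub_add_cancel_of_le]
  rw [single_le_iff]; omega

lemma isPolymatroidal_span {A : Set (Fin n →₀ ℕ)} {d : ℕ} (hd : ∀ a ∈ A, a.degree = d)
    (hA : HasExchange A) :
    IsPolymatroidal (Ideal.span ((fun a => monomial a (1 : K)) '' A)) := by
  have hmin := minGens_span_monomial (K := K) hd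
  refine ⟨⟨A, rfl⟩, ⟨d, fun u hu => hd u (hmin ▸ hu)⟩, fun u hu v hv i hi => ?_⟩
  rw [hmin] at hu hv ⊢
  obtain ⟨j, hj, w, hw, hwe⟩ := hA u hu v hv i hi
  refine ⟨j, hj, ?_⟩
  have hle : single i 1 ≤ u := single_le_iff.2 (by omega)
  rwa [tsub_add_eq_add_tsub hle, ← hwe, add_tsub_cancel_right]

end MonomialIdeals

theorem proposition4p2 {K : Type*} [Field K] {n : ℕ} (I : Ideal (MvPolynomial (Fin n) K))
    (hI : IsPolymatroidal I) (h : IsGeneratedInDegree I 2 ∨ n ≤ 3) :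
    IsPolymatroidal (socleIdeal I) := by
  have hdeg : ∀ d, IsGeneratedInDegree I d →
      ∀ w ∈ {w | w ∈ minGens (Submodule.colon I
        (maxGradedIdeal K n : Set (MvPolynomial (Fin n) K))) ∧
        ∃ u ∈ minGens I, w.degree + 1 = u.degree}, w.degree = d - 1 := by
    rintro d hd w ⟨-, u, hu, hwu⟩
    rw [hd u hu] at hwu
    omega
  rcases h with h | h
  · exact isPolymatroidal_span (hdeg 2 h) (.of_degree_eq_one (hdeg 2 h))
  · obtain ⟨d, hd⟩ := hI.equigenerated
    refine isPolymatroidal_span (hdeg d hd) ?_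
    intro u hu v hv i hi
    have hsoc := hI.hasExchange.socle (by simpa using h) hd
    -- The index `i` being exchanged witnesses that there is a variable, so `n = 0` needs no
    -- separate case.
    simp only [mem_minGens_colon_iff hd ⟨i⟩, Set.mem_ofPred_eq] at hu hv ⊢
    exact hsoc u hu v hv i hi
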